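/- A \emph{discrete filtered set} is a family $\Omega=(\Omega_L)_{L\in\mathbb{R}_{\ge0}}$ of finite subsets of $\mathbb{C}$ such that $\Omega_{L_1}\subseteq\Omega_{L_2}$ for $L_1\le L_2$ and $\Omega_\delta=\emptyset$ for some $\delta>0$. Fix one, let $\mathcal{S}_\Omega=\{(\lambda,\omega)\in\mathbb{R}_{\ge0}\times\mathbb{C}\mid\omega\in\Omega_\lambda\}$, and let $\mathcal{M}_\Omega=(\mathbb{R}_{\ge0}\times\mathbb{C})\setminus\overline{\mathcal{S}_\Omega}$, the closure being taken in $\mathbb{R}_{\ge0}\times\mathbb{C}$. A Lipschitz path $\gamma\colon[0,t_*]\to\mathbb{C}$ ($t_*\ge0$) with $\gamma(0)=0$ is \emph{$\Omega$-allowed} if $\big(L(\gamma|_{[0,t]}),\gamma(t)\big)\in\mathcal{M}_\Omega$ for all $t\in[0,t_*]$, where $L$ denotes the length of a path. An \emph{$\Omega$-endless Riemann surface} is a triple $(X,\mathfrak{p},\underline{0})$ where $X$ is a connected Riemann surface, $\mathfrak{p}\colon X\to\mathbb{C}$ is a local biholomorphism, $\underline{0}\in\mathfrak{p}^{-1}(0)$,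 and every $\Omega$-allowed path $\gamma\colon[0,t_*]\to\mathbb{C}$ has a continuous lift $\underline{\gamma}\colon[0,t_*]\to X$ with $\mathfrak{p}\circ\underline{\gamma}=\gamma$ and $\underline{\gamma}(0)=\underline{0}$. \textbf{Proposition.} There exists an $\Omega$-endless Riemann surface $(X_\Omega,\mathfrak{p}_\Omega,\underline{0}_\Omega)$ that is cofinal: for every $\Omega$-endless Riemann surface $(\tilde X,\tilde{\mathfrak{p}},\tilde{\underline{0}})$ there is a local biholomorphism $\mathfrak{q}\colon X_\Omega\to\tilde X$ with $\mathfrak{q}(\underline{0}_\Omega)=\tilde{\underline{0}}$ and $\tilde{\mathfrak{p}}\circ\mathfrak{q}=\mathfrak{p}_\Omega$. It is unique up to isomorphism: for every cofinal $\Omega$-endless Riemann surface $(X',\mathfrak{p}',\underline{0}')$ there is a biholomorphism $\Phi\colon X_\Omega\to X'$ with $\Phi(\underline{0}_\Omega)=\underline{0}'$ and $\mathfrak{p}'\circ\Phi=\mathfrak{p}_\Omega$. Moreover, $X_\Omega$ is simply connected. -/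

import Mathlib

open Set Topology
open scoped NNReal ENNReal Manifold ContDiff

universe u

/-- A discrete filtered set: a nondecreasing family of finite subsets of `ℂ` indexed by `ℝ≥0`,
one of which has positive index and is empty. -/
structure DiscreteFilteredSet where
  /-- the set `Ω_L` -/
  level : ℝ≥0 → Set ℂ
  finite_level : ∀ L, (level L).Finite
  level_subset : ∀ L₁ L₂, L₁ ≤ L₂ → level L₁ ⊆ level L₂
  exists_level_eq_empty : ∃ δ : ℝ≥0, 0 < δ ∧ level δ = ∅

namespace DiscreteFilteredSet

/-- The set of all `(λ, ω)` with `ω ∈ Ω_λ`. -/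
def singularSet (Ω : DiscreteFilteredSet) : Set (ℝ≥0 × ℂ) :=
  {x | x.2 ∈ Ω.level x.1}

/-- The allowed open set: the complement of the closure of `singularSet` in `ℝ≥0 × ℂ`. -/
def allowedSet (Ω : DiscreteFilteredSet) : Set (ℝ≥0 × ℂ) :=
  (closure Ω.singularSet)ᶜ

/-- The length of the restriction of `γ` to `[0, t]`. It is finite whenever `γ` is Lipschitz on
`[0, t]`, which is the only case in which it is used. -/
noncomputable def pathLength (γ : ℝ → ℂ) (t : ℝ) : ℝ≥0 :=
  (eVariationOn γ (Icc 0 t)).toNNReal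

/-- `γ`, restricted to `[0, T]`, is an `Ω`-allowed path: it is Lipschitz, starts at `0`, and
`(L(γ|[0,t]), γ t)` stays in the allowed open set. The values of `γ` off `[0, T]` play no role. -/
structure IsAllowedPath (Ω : DiscreteFilteredSet) (T : ℝ) (γ : ℝ → ℂ) : Prop where
  nonneg : 0 ≤ T
  lipschitz : ∃ K : ℝ≥0, LipschitzOnWith K γ (Icc 0 T)
  start : γ 0 = 0
  mem_allowedSet : ∀ t ∈ Icc 0 T, (pathLength γ t, γ t) ∈ Ω.allowedSet

end DiscreteFilteredSet

/-- An `Ω`-endless Riemann surface `(X, p, 0)`: a connected Riemann surface `X` (a connected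
Hausdorff complex manifold of dimension one), a local biholomorphism `p : X → ℂ`, and a point of
`X` above `0` from which every `Ω`-allowed path lifts to a continuous path in `X`. -/
structure EndlessRiemannSurface (Ω : DiscreteFilteredSet) where
  carrier : Type u
  [topologicalSpace : TopologicalSpace carrier]
  [chartedSpace : ChartedSpace ℂ carrier]
  [isManifold : IsManifold 𝓘(ℂ) ω carrier]
  [t2Space : T2Space carrier]
  [connectedSpace : ConnectedSpace carrier]
  proj : carrier → ℂ
  isLocalDiffeomorph_proj : IsLocalDiffeomorph 𝓘(ℂ) 𝓘(ℂ) ω proj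
  base : carrier
  proj_base : proj base = 0
  exists_lift : ∀ (T : ℝ) (γ : ℝ → ℂ), Ω.IsAllowedPath T γ →
    ∃ Γ : ℝ → carrier, ContinuousOn Γ (Icc 0 T) ∧ Γ 0 = base ∧ ∀ t ∈ Icc 0 T, proj (Γ t) = γ t

namespace EndlessRiemannSurface

attribute [instance] topologicalSpace chartedSpace isManifold t2Space connectedSpace

variable {Ω : DiscreteFilteredSet}

/-- `q` is a local biholomorphism compatible with the projections and the base points. -/
structure IsMorphism (X Y : EndlessRiemannSurface.{u} Ω) (q : X.carrier → Y.carrier) : Prop where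
  isLocalDiffeomorph : IsLocalDiffeomorph 𝓘(ℂ) 𝓘(ℂ) ω q
  map_base : q X.base = Y.base
  proj_comp : Y.proj ∘ q = X.proj

/-- `X` is cofinal: it maps to every `Ω`-endless Riemann surface. -/
def IsCofinal (X : EndlessRiemannSurface.{u} Ω) : Prop :=
  ∀ Y : EndlessRiemannSurface.{u} Ω, ∃ q : X.carrier → Y.carrier, IsMorphism X Y q

/-- `X` and `Y` are isomorphic: there is a biholomorphism between them that is compatible with
the projections and the base points. -/
def IsIsomorphic (X Y : EndlessRiemannSurface.{u} Ω) : Prop :=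
  ∃ Φ : Diffeomorph 𝓘(ℂ) 𝓘(ℂ) X.carrier Y.carrier ω,
    Φ X.base = Y.base ∧ Y.proj ∘ Φ = X.proj

end EndlessRiemannSurface

/-! Points of the universal surface are allowed paths, two being identified when they have the same
end point and their lifts to every endless surface have the same end point. Cofinality is then built
in: a class goes to the common end point of the lifts. It remains to make the quotient an endless
surface. An allowed path can be prolonged by short segments (`IsAllowedPath.exists_appendSegment`),
the lifts of these prolongations form a section over a disc in every surface
(`EndlessRiemannSurface.exists_section`), and these germs define an étale topology. It is Hausdorff
because distinct points of a fibre have distinct images in some surface, and an allowed path lifts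
to the classes of its truncations.

Everything else rests on uniqueness of lifts (`eqOn_of_proj_eqOn`). Morphisms in both directions
between two surfaces are mutually inverse, whence uniqueness. For simple connectedness, the homotopy
classes of paths from the base point of a cofinal `Y` form an endless surface, so there is a
morphism `q` from `Y` to it. The lift of a path `α` from the base point ends at the class of `α`,
but also at `q` of the end point of `α`; so this class depends only on the end point. -/

open Filter

/-! ### Étale topologies -/

/-- A family of germs of sections of `p : E → B`, one through every point of `E`, such that the
germs along a section are those of the section itself. The value of `s e` matters only near
`p e`. -/
structure IsGermFamily {E B : Type*} [TopologicalSpace B] (p : E → B) (s : E → B → E) : Prop where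
  self : ∀ e, s e (p e) = e
  proj : ∀ e, ∀ᶠ w in 𝓝 (p e), p (s e w) = w
  coherent : ∀ e, ∀ᶠ w in 𝓝 (p e), ∀ᶠ v in 𝓝 w, s (s e w) v = s e v

/-- The étale topology defined by a family of germs of sections. -/
@[reducible] def etaleTopology {E B : Type*} [TopologicalSpace B] (p : E → B) (s : E → B → E) :
    TopologicalSpace E :=
  TopologicalSpace.mkOfNhds fun e => map (s e) (𝓝 (p e))

namespace IsGermFamily

variable {E B : Type*} [TopologicalSpace B] {p : E → B} {s : E → B → E}

theorem nhds_eq (h : IsGermFamily p s) (e : E) :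
    @nhds E (etaleTopology p s) e = map (s e) (𝓝 (p e)) := by
  refine TopologicalSpace.nhds_mkOfNhds _ _ (fun a => ?_) fun a S hS => ?_
  · refine fun S hS => ?_
    have : s a (p a) ∈ S := (mem_map.1 hS |> mem_of_mem_nhds :)
    rwa [h.self] at this
  · rw [eventually_map]
    filter_upwards [h.proj a, h.coherent a, eventually_eventually_nhds.2 (mem_map.1 hS)]
      with w hw hw' hS'
    rw [mem_map, hw]
    filter_upwards [hw', hS'] with v hv hv'
    rw [mem_preimage, hv]
    exact hv'

/-- By `nhds_eq`, `p` carries `𝓝 e` to `𝓝 (p e)`, so it is continuous and open; it is injective on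
the image of the germ `s e`, which is a neighbourhood of `e`. -/
theorem isLocalHomeomorph (h : IsGermFamily p s) :
    @IsLocalHomeomorph E B (etaleTopology p s) _ p := by
  let := etaleTopology p s
  have hmap (e : E) : map p (𝓝 e) = 𝓝 (p e) := by
    rw [h.nhds_eq, map_map]
    exact (map_congr (h.proj e)).trans map_id
  have hcont : Continuous p := continuous_iff_continuousAt.2 fun e => (hmap e).le
  have hopen : IsOpenMap p := isOpenMap_iff_nhds_le.2 fun e => (hmap e).ge
  refine isLocalHomeomorph_iff_isOpenEmbedding_restrict.2 fun e => ?_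
  have hU : s e '' {w | p (s e w) = w} ∈ 𝓝 e := by
    rw [h.nhds_eq]
    exact image_mem_map (h.proj e)
  refine ⟨interior _, interior_mem_nhds.2 hU, .of_continuous_injective_isOpenMap
    (hcont.comp continuous_subtype_val) ?_ (hopen.domRestrict isOpen_interior)⟩
  rintro ⟨x, hx⟩ ⟨y, hy⟩ hxy
  obtain ⟨v, hv, rfl⟩ := interior_subset hx
  obtain ⟨w, hw, rfl⟩ := interior_subset hy
  have hvw : p (s e v) = p (s e w) := hxy
  rw [mem_ofPred_eq] at hv hw
  rw [hv, hw] at hvw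
  subst hvw
  rfl

theorem continuousWithinAt {A : Type*} [TopologicalSpace A] (h : IsGermFamily p s) {f : A → E}
    {S : Set A} {a : A} (hf : ContinuousWithinAt (p ∘ f) S a)
    (hs : ∀ᶠ b in 𝓝[S] a, f b = s (f a) (p (f b))) :
    @ContinuousWithinAt A E _ (etaleTopology p s) f S a := by
  let := etaleTopology p s
  rw [ContinuousWithinAt, h.nhds_eq]
  have : Tendsto (s (f a) ∘ p ∘ f) (𝓝[S] a) (map (s (f a)) (𝓝 (p (f a)))) :=
    tendsto_map.comp hf
  exact this.congr' (hs.mono fun b hb => hb.symm)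

theorem continuousAt_iff {F : Type*} [TopologicalSpace F] (h : IsGermFamily p s) {f : E → F}
    {e : E} : @ContinuousAt E F (etaleTopology p s) _ f e ↔
      Tendsto (fun w => f (s e w)) (𝓝 (p e)) (𝓝 (f e)) := by
  let := etaleTopology p s
  rw [ContinuousAt, h.nhds_eq, tendsto_map'_iff]
  rfl

end IsGermFamily

/-! ### Complex structure pulled back by a local homeomorphism -/

/-- The charted space structure for which the restrictions of a local homeomorphism are charts. -/
@[reducible] noncomputable def IsLocalHomeomorph.pullbackChartedSpace {E H : Type*}
    [TopologicalSpace E]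
    [TopologicalSpace H] {p : E → H} (hp : IsLocalHomeomorph p) : ChartedSpace H E where
  atlas := {e | p = e}
  chartAt x := (hp x).choose
  mem_chart_source x := (hp x).choose_spec.1
  chart_mem_atlas x := (hp x).choose_spec.2

/-- All charts have the same underlying function `p`, so coordinate changes are identities where
defined. -/
theorem IsLocalHomeomorph.isManifold {E : Type*} [TopologicalSpace E] {p : E → ℂ}
    (hp : IsLocalHomeomorph p) : letI := hp.pullbackChartedSpace; IsManifold 𝓘(ℂ) ω E := by
  let := hp.pullbackChartedSpace
  refine isManifold_of_contDiffOn 𝓘(ℂ) ω E fun e e' he he' => ?_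
  refine contDiffOn_id.congr fun z hz => ?_
  have he : p = e := he
  have he' : p = e' := he'
  have hz : z ∈ e.target := by
    simp only [mfld_simps] at hz
    exact hz.1
  simp only [mfld_simps]
  rw [← he', he, e.right_inv hz]

theorem IsLocalHomeomorph.isLocalDiffeomorph {E : Type*} [TopologicalSpace E] {p : E → ℂ}
    (hp : IsLocalHomeomorph p) :
    letI := hp.pullbackChartedSpace; IsLocalDiffeomorph 𝓘(ℂ) 𝓘(ℂ) ω p := by
  let := hp.pullbackChartedSpace
  have := hp.isManifold
  intro x
  have hmem := IsManifold.chart_mem_maximalAtlas (I := 𝓘(ℂ)) (n := ω) x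
  refine ⟨⟨(chartAt ℂ x).toPartialEquiv, (chartAt ℂ x).open_source, (chartAt ℂ x).open_target,
    contMDiffOn_of_mem_maximalAtlas hmem, contMDiffOn_symm_of_mem_maximalAtlas hmem⟩,
    mem_chart_source ℂ x, fun y _ => ?_⟩
  exact congrFun (hp x).choose_spec.2 y

/-! ### Lifts through local diffeomorphisms, and length of Lipschitz paths -/

/-- A continuous lift of a local diffeomorphism through a local diffeomorphism is a local
diffeomorphism. -/
theorem IsLocalDiffeomorph.of_comp {𝕜 : Type*} [NontriviallyNormedField 𝕜]
    {E F G : Type*} [NormedAddCommGroup E] [NormedSpace 𝕜 E] [NormedAddCommGroup F]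
    [NormedSpace 𝕜 F] [NormedAddCommGroup G] [NormedSpace 𝕜 G] {H K L : Type*}
    [TopologicalSpace H] [TopologicalSpace K] [TopologicalSpace L] {I : ModelWithCorners 𝕜 E H}
    {J : ModelWithCorners 𝕜 F K} {I' : ModelWithCorners 𝕜 G L} {M N P : Type*}
    [TopologicalSpace M] [ChartedSpace H M] [TopologicalSpace N] [ChartedSpace K N]
    [TopologicalSpace P] [ChartedSpace L P] {n : ℕ∞ω} {f : M → N} {g : N → P}
    (hgf : IsLocalDiffeomorph I I' n (g ∘ f)) (hg : IsLocalDiffeomorph J I' n g)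
    (hf : Continuous f) : IsLocalDiffeomorph I J n f := by
  intro x
  obtain ⟨Φ, hx, hΦ⟩ := hgf x
  obtain ⟨Ψ, hy, hΨ⟩ := hg (f x)
  -- Continuity of `f` enters here; on the part of `Φ.source` inside this open set, `f` is `Ψ.symm ∘
  -- Φ`.
  have hS : IsOpen (f ⁻¹' Ψ.source) := Ψ.open_source.preimage hf
  let e := Φ.toOpenPartialHomeomorph.restrOpen _ hS
  have hes : e.source = Φ.source ∩ f ⁻¹' Ψ.source :=
    Φ.toOpenPartialHomeomorph.restrOpen_source _ hS
  have hsub : e.source ⊆ Φ.source := hes ▸ inter_subset_left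
  have htgt : e.target ⊆ Φ.target := inter_subset_left
  let Φ' : PartialDiffeomorph I I' M P n :=
    ⟨e.toPartialEquiv, e.open_source, e.open_target, Φ.contMDiffOn_toFun.mono hsub,
      Φ.contMDiffOn_invFun.mono htgt⟩
  have key : ∀ y ∈ e.source, Φ y = Ψ (f y) := fun y hy => by
    rw [hes] at hy
    rw [← hΦ hy.1, ← hΨ hy.2]
    rfl
  refine ⟨Φ'.trans Ψ.symm, ?_, fun y hy' => ?_⟩
  · have hxe : x ∈ e.source := hes ▸ ⟨hx, hy⟩
    refine ⟨hxe, ?_⟩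
    change Φ x ∈ Ψ.target
    rw [key x hxe]
    exact Ψ.map_source hy
  · have hye : y ∈ e.source := hy'.1
    change f y = Ψ.symm (Φ y)
    rw [key y hye]
    exact (Ψ.left_inv (hes ▸ hye : y ∈ Φ.source ∩ f ⁻¹' Ψ.source).2).symm

/-- Two lifts of a function on a preconnected set through a separated locally injective map agree
if they agree at one point. -/
theorem IsSeparatedMap.eqOn_of_eqOn_comp {A X Y : Type*} [TopologicalSpace A]
    [TopologicalSpace X] {p : X → Y} (sep : IsSeparatedMap p)
    (inj : IsLocallyInjective p) {S : Set A} (hS : IsPreconnected S) {f g : A → X}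
    (hf : ContinuousOn f S) (hg : ContinuousOn g S) (h : EqOn (p ∘ f) (p ∘ g) S) {a : A}
    (ha : a ∈ S) (hfg : f a = g a) : EqOn f g S := by
  have := isPreconnected_iff_preconnectedSpace.1 hS
  intro b hb
  exact congrFun (sep.eq_of_comp_eq inj (continuousOn_iff_continuous_domRestrict.1 hf)
    (continuousOn_iff_continuous_domRestrict.1 hg) (funext fun c => h c.2) ⟨a, ha⟩ hfg) ⟨b, hb⟩

theorem LipschitzOnWith.eVariationOn_Icc_le {E : Type*} [PseudoEMetricSpace E] {f : ℝ → E}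
    {K : ℝ≥0} {a b : ℝ} (hf : LipschitzOnWith K f (Icc a b)) :
    eVariationOn f (Icc a b) ≤ K * ENNReal.ofReal (b - a) := by
  rcases lt_or_ge b a with hab | hab
  · simp [Icc_eq_empty hab.not_ge, eVariationOn]
  refine (hf.comp_eVariationOn_le (g := id) (mapsTo_id _)).trans ?_
  gcongr
  have := (monotoneOn_id (s := Icc a b)).eVariationOn_eq (left_mem_Icc.2 hab)
    (right_mem_Icc.2 hab)
  rw [inter_self] at this
  exact this.le

/-! ### Prolonging allowed paths by segments -/

namespace DiscreteFilteredSet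

/-- The path `γ` on `[0, T]`, followed on `[T, T + 1]` by the segment from `γ T` to `w`. -/
noncomputable def appendSegment (T : ℝ) (γ : ℝ → ℂ) (w : ℂ) (t : ℝ) : ℂ :=
  γ (min t T) + max (t - T) 0 • (w - γ T)

section appendSegment

variable {T : ℝ} {γ : ℝ → ℂ} {w : ℂ} {t : ℝ}

theorem appendSegment_of_le (h : t ≤ T) : appendSegment T γ w t = γ t := by
  simp [appendSegment, h]

theorem appendSegment_of_ge (h : T ≤ t) :
    appendSegment T γ w t = AffineMap.lineMap (γ T) w (t - T) := by
  simp [appendSegment, h, AffineMap.lineMap_apply, add_comm]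

theorem appendSegment_end : appendSegment T γ w (T + 1) = w := by
  simp [appendSegment_of_ge]

theorem lipschitzOnWith_appendSegment {K : ℝ≥0} (hγ : LipschitzOnWith K γ (Icc 0 T))
    (hT : 0 ≤ T) : LipschitzOnWith (K + ‖w - γ T‖₊) (appendSegment T γ w) (Icc 0 (T + 1)) := by
  refine LipschitzOnWith.of_dist_le_mul fun s hs t ht => ?_
  have h1 : dist (γ (min s T)) (γ (min t T)) ≤ K * dist s t := by
    refine (hγ.dist_le_mul _ ⟨le_min hs.1 hT, min_le_right _ _⟩ _
      ⟨le_min ht.1 hT, min_le_right _ _⟩).trans ?_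
    gcongr
    simpa [Real.dist_eq] using abs_min_sub_min_le_max s T t T
  have h2 : dist (max (s - T) 0 • (w - γ T)) (max (t - T) 0 • (w - γ T)) ≤
      ‖w - γ T‖₊ * dist s t := by
    rw [dist_eq_norm, ← sub_smul, norm_smul, mul_comm, coe_nnnorm]
    gcongr
    rw [Real.norm_eq_abs, Real.dist_eq]
    simpa using abs_max_sub_max_le_max (s - T) 0 (t - T) 0
  calc _ ≤ _ := dist_add_add_le _ _ _ _
    _ ≤ _ := add_le_add h1 h2
    _ = _ := by push_cast; ring

theorem eVariationOn_appendSegment_le (ht : t ∈ Icc T (T + 1)) :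
    eVariationOn (appendSegment T γ w) (Icc T t) ≤ ‖w - γ T‖₊ := by
  have : LipschitzOnWith ‖w - γ T‖₊ (appendSegment T γ w) (Icc T t) := by
    refine LipschitzOnWith.of_dist_le_mul fun s hs r hr => ?_
    rw [appendSegment_of_ge hs.1, appendSegment_of_ge hr.1, dist_lineMap_lineMap, mul_comm,
      dist_comm (γ T), dist_eq_norm w, coe_nnnorm, dist_sub_right]
  refine this.eVariationOn_Icc_le.trans ?_
  calc (‖w - γ T‖₊ : ℝ≥0∞) * ENNReal.ofReal (t - T) ≤ ‖w - γ T‖₊ * 1 := by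
        gcongr
        exact ENNReal.ofReal_le_one.2 (by linarith [ht.2])
    _ = _ := mul_one _

theorem pathLength_appendSegment_of_le (ht : t ≤ T) :
    pathLength (appendSegment T γ w) t = pathLength γ t := by
  rw [pathLength, pathLength, eVariationOn.eq_of_eqOn]
  exact fun s hs => appendSegment_of_le (hs.2.trans ht)

theorem dist_pathLength_appendSegment_le {K : ℝ≥0} (hγ : LipschitzOnWith K γ (Icc 0 T))
    (hT : 0 ≤ T) (ht : t ∈ Icc T (T + 1)) :
    dist (pathLength (appendSegment T γ w) t) (pathLength γ T) ≤ ‖w - γ T‖ := by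
  have hadd : eVariationOn (appendSegment T γ w) (Icc 0 t) =
      eVariationOn γ (Icc 0 T) + eVariationOn (appendSegment T γ w) (Icc T t) := by
    have := eVariationOn.Icc_add_Icc (appendSegment T γ w) (s := univ) hT ht.1 (mem_univ _)
    simp only [univ_inter] at this
    rw [← this, eVariationOn.eq_of_eqOn (f := appendSegment T γ w) (f' := γ) (s := Icc 0 T)
      fun s hs => appendSegment_of_le hs.2]
  -- `toNNReal` sends `⊤` to `0`, so it is additive only on finite lengths.
  have hfin : eVariationOn γ (Icc 0 T) ≠ ⊤ :=
    ne_top_of_le_ne_top (by finiteness) hγ.eVariationOn_Icc_le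
  have hle := eVariationOn_appendSegment_le (γ := γ) (w := w) ht
  have hfin' : eVariationOn (appendSegment T γ w) (Icc T t) ≠ ⊤ :=
    ne_top_of_le_ne_top (by finiteness) hle
  rw [pathLength, pathLength, hadd, ENNReal.toNNReal_add hfin hfin', NNReal.dist_eq]
  rw [NNReal.coe_add, add_sub_cancel_left, abs_of_nonneg NNReal.zero_le_coe, ← coe_nnnorm,
    NNReal.coe_le_coe]
  exact (ENNReal.toNNReal_mono ENNReal.coe_ne_top hle).trans_eq (ENNReal.toNNReal_coe _)

end appendSegment

variable {Ω : DiscreteFilteredSet} {T : ℝ} {γ : ℝ → ℂ}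

theorem isOpen_allowedSet : IsOpen Ω.allowedSet := isClosed_closure.isOpen_compl

/-- No singular point has first coordinate below `δ`, so `Iio δ ×ˢ univ` is a neighbourhood of the
origin missing `singularSet`. -/
theorem zero_mem_allowedSet : ((0, 0) : ℝ≥0 × ℂ) ∈ Ω.allowedSet := by
  obtain ⟨δ, hδ, hΩ⟩ := Ω.exists_level_eq_empty
  intro h
  obtain ⟨x, hx, hxS⟩ := mem_closure_iff_nhds.1 h (Iio δ ×ˢ univ)
    (prod_mem_nhds (Iio_mem_nhds hδ) univ_mem)
  have := Ω.level_subset _ _ (le_of_lt hx.1) hxS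
  rw [hΩ] at this
  exact this

theorem isAllowedPath_zero : Ω.IsAllowedPath 0 0 where
  nonneg := le_rfl
  lipschitz := ⟨0, (LipschitzWith.const 0).lipschitzOnWith⟩
  start := rfl
  mem_allowedSet t ht := by
    have : pathLength 0 t = 0 := by
      rw [pathLength, eVariationOn.constant_on]
      · rfl
      · rintro _ ⟨x, -, rfl⟩ _ ⟨y, -, rfl⟩
        rfl
    rw [this]
    exact zero_mem_allowedSet

namespace IsAllowedPath

theorem continuousOn (h : Ω.IsAllowedPath T γ) : ContinuousOn γ (Icc 0 T) :=
  h.lipschitz.choose_spec.continuousOn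

theorem truncate (h : Ω.IsAllowedPath T γ) {t : ℝ} (ht : t ∈ Icc 0 T) :
    Ω.IsAllowedPath t γ where
  nonneg := ht.1
  lipschitz := h.lipschitz.imp fun _ hK => hK.mono (Icc_subset_Icc_right ht.2)
  start := h.start
  mem_allowedSet s hs := h.mem_allowedSet s ⟨hs.1, hs.2.trans ht.2⟩

/-- Along the added segment both the length and the position move by at most `‖w - γ T‖`, so a ball
in the open allowed set around the final pair gives the radius. -/
theorem exists_appendSegment (h : Ω.IsAllowedPath T γ) :
    ∃ r > 0, ∀ w ∈ Metric.ball (γ T) r, Ω.IsAllowedPath (T + 1) (appendSegment T γ w) := by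
  obtain ⟨r, hr, hball⟩ := Metric.isOpen_iff.1 isOpen_allowedSet _
    (h.mem_allowedSet T (right_mem_Icc.2 h.nonneg))
  obtain ⟨K, hK⟩ := h.lipschitz
  refine ⟨r, hr, fun w hw => ⟨by linarith [h.nonneg],
    ⟨_, lipschitzOnWith_appendSegment hK h.nonneg⟩, ?_, fun t ht => ?_⟩⟩
  · rw [appendSegment_of_le h.nonneg, h.start]
  · rw [Metric.mem_ball, dist_eq_norm] at hw
    rcases le_total t T with htT | htT
    · rw [appendSegment_of_le htT, pathLength_appendSegment_of_le htT]
      exact h.mem_allowedSet t ⟨ht.1, htT⟩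
    · refine hball ?_
      rw [Metric.mem_ball, Prod.dist_eq, max_lt_iff]
      refine ⟨(dist_pathLength_appendSegment_le hK h.nonneg ⟨htT, ht.2⟩).trans_lt hw, ?_⟩
      rw [appendSegment_of_ge htT, dist_lineMap_left, dist_comm, dist_eq_norm]
      refine lt_of_le_of_lt (mul_le_of_le_one_left (norm_nonneg _) ?_) hw
      rw [Real.norm_eq_abs, abs_of_nonneg (by linarith)]
      linarith [ht.2]

end IsAllowedPath

end DiscreteFilteredSet

/-! ### Morphisms and lifts of allowed paths -/

namespace EndlessRiemannSurface

open DiscreteFilteredSet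

variable {Ω : DiscreteFilteredSet} {T : ℝ} {γ : ℝ → ℂ}

/-- An `Ω`-endless Riemann surface given by a local homeomorphism, with the complex structure
for which this local homeomorphism is locally biholomorphic. -/
@[reducible] noncomputable def ofLocalHomeomorph {E : Type u} [TopologicalSpace E] [T2Space E]
    [ConnectedSpace E] (p : E → ℂ) (hp : IsLocalHomeomorph p) (b : E) (hb : p b = 0)
    (hlift : ∀ (T : ℝ) (γ : ℝ → ℂ), Ω.IsAllowedPath T γ →
      ∃ Γ : ℝ → E, ContinuousOn Γ (Icc 0 T) ∧ Γ 0 = b ∧ ∀ t ∈ Icc 0 T, p (Γ t) = γ t) :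
    EndlessRiemannSurface.{u} Ω :=
  letI := hp.pullbackChartedSpace
  haveI := hp.isManifold
  { carrier := E
    proj := p
    isLocalDiffeomorph_proj := hp.isLocalDiffeomorph
    base := b
    proj_base := hb
    exists_lift := hlift }

variable (X Y : EndlessRiemannSurface.{u} Ω)

theorem isLocalHomeomorph_proj : IsLocalHomeomorph Y.proj :=
  Y.isLocalDiffeomorph_proj.isLocalHomeomorph

theorem isSeparatedMap_proj : IsSeparatedMap Y.proj := T2Space.isSeparatedMap _

variable {X Y}

theorem eqOn_of_proj_eqOn {A : Type*} [TopologicalSpace A] {S : Set A} (hS : IsPreconnected S)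
    {f g : A → Y.carrier} (hf : ContinuousOn f S) (hg : ContinuousOn g S)
    (h : ∀ a ∈ S, Y.proj (f a) = Y.proj (g a)) {a : A} (ha : a ∈ S) (hfg : f a = g a) :
    EqOn f g S :=
  Y.isSeparatedMap_proj.eqOn_of_eqOn_comp Y.isLocalHomeomorph_proj.isLocallyInjective hS hf hg h
    ha hfg

theorem isMorphism_of_continuous {q : X.carrier → Y.carrier} (hq : Continuous q)
    (hbase : q X.base = Y.base) (hproj : Y.proj ∘ q = X.proj) : IsMorphism X Y q where
  isLocalDiffeomorph :=
    .of_comp (hproj ▸ X.isLocalDiffeomorph_proj) Y.isLocalDiffeomorph_proj hq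
  map_base := hbase
  proj_comp := hproj

theorem IsMorphism.continuous {q : X.carrier → Y.carrier} (hq : IsMorphism X Y q) :
    Continuous q :=
  hq.isLocalDiffeomorph.contMDiff.continuous

theorem IsMorphism.proj_apply {q : X.carrier → Y.carrier} (hq : IsMorphism X Y q)
    (x : X.carrier) : Y.proj (q x) = X.proj x :=
  congrFun hq.proj_comp x

/-- Both `r ∘ q` and `id` lift `X.proj` and fix the base point of the connected surface `X`. -/
theorem IsMorphism.comp_eq_id {q : X.carrier → Y.carrier} {r : Y.carrier → X.carrier}
    (hq : IsMorphism X Y q) (hr : IsMorphism Y X r) (x : X.carrier) : r (q x) = x :=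
  eqOn_of_proj_eqOn (f := r ∘ q) (g := id) isPreconnected_univ
    (hr.continuous.comp hq.continuous).continuousOn continuousOn_id
    (fun a _ => by simp [hr.proj_apply, hq.proj_apply]) (mem_univ X.base)
    (by simp [hq.map_base, hr.map_base]) (mem_univ x)

/-- Two `Ω`-endless Riemann surfaces with morphisms in both directions are isomorphic. -/
theorem IsMorphism.isIsomorphic {q : X.carrier → Y.carrier} {r : Y.carrier → X.carrier}
    (hq : IsMorphism X Y q) (hr : IsMorphism Y X r) : X.IsIsomorphic Y :=
  ⟨{  toFun := q
      invFun := r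
      left_inv := hq.comp_eq_id hr
      right_inv := hr.comp_eq_id hq
      contMDiff_toFun := hq.isLocalDiffeomorph.contMDiff
      contMDiff_invFun := hr.isLocalDiffeomorph.contMDiff }, hq.map_base, hq.proj_comp⟩

variable (Y)

/-- The lift of an allowed path, starting at the base point. -/
noncomputable def lift (h : Ω.IsAllowedPath T γ) : ℝ → Y.carrier :=
  (Y.exists_lift T γ h).choose

variable {Y} (h : Ω.IsAllowedPath T γ)

theorem continuousOn_lift : ContinuousOn (Y.lift h) (Icc 0 T) :=
  (Y.exists_lift T γ h).choose_spec.1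

theorem lift_zero : Y.lift h 0 = Y.base :=
  (Y.exists_lift T γ h).choose_spec.2.1

theorem proj_lift {t : ℝ} (ht : t ∈ Icc 0 T) : Y.proj (Y.lift h t) = γ t :=
  (Y.exists_lift T γ h).choose_spec.2.2 t ht

theorem eqOn_lift {Γ : ℝ → Y.carrier} (hΓ : ContinuousOn Γ (Icc 0 T)) (h0 : Γ 0 = Y.base)
    (hproj : ∀ t ∈ Icc 0 T, Y.proj (Γ t) = γ t) : EqOn Γ (Y.lift h) (Icc 0 T) :=
  eqOn_of_proj_eqOn isPreconnected_Icc hΓ (continuousOn_lift h)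
    (fun t ht => (hproj t ht).trans (proj_lift h ht).symm) (left_mem_Icc.2 h.nonneg)
    (h0.trans (lift_zero h).symm)

theorem lift_truncate {t : ℝ} (ht : t ∈ Icc 0 T) :
    Y.lift (h.truncate ht) t = Y.lift h t := by
  have hsub : Icc 0 t ⊆ Icc 0 T := Icc_subset_Icc_right ht.2
  exact (eqOn_lift (h.truncate ht) ((continuousOn_lift h).mono hsub) (lift_zero h)
    (fun s hs => proj_lift h (hsub hs)) (right_mem_Icc.2 ht.1)).symm

theorem lift_appendSegment_left {w : ℂ} (h' : Ω.IsAllowedPath (T + 1) (appendSegment T γ w)) :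
    Y.lift h' T = Y.lift h T := by
  have hsub : Icc 0 T ⊆ Icc 0 (T + 1) := Icc_subset_Icc_right (by linarith)
  refine eqOn_lift h ((continuousOn_lift h').mono hsub) (lift_zero h') (fun s hs => ?_)
    (right_mem_Icc.2 h.nonneg)
  rw [proj_lift h' (hsub hs), appendSegment_of_le hs.2]

/-- If an allowed path can be continued along all segments in a disc, then the end points of the
lifts form a section over this disc. -/
theorem exists_section {r : ℝ} (hr : 0 < r) (H : ∀ w ∈ Metric.ball (γ T) r,
      Ω.IsAllowedPath (T + 1) (appendSegment T γ w)) :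
    ∃ σ : ℂ → Y.carrier, ContinuousOn σ (Metric.ball (γ T) r) ∧
      (∀ z ∈ Metric.ball (γ T) r, Y.proj (σ z) = z) ∧ σ (γ T) = Y.lift h T ∧
      ∀ w (hw : w ∈ Metric.ball (γ T) r), Y.lift (H w hw) (T + 1) = σ w := by
  classical
  let f : C(unitInterval × Metric.ball (γ T) r, ℂ) :=
    ⟨fun x => AffineMap.lineMap (γ T) (x.2 : ℂ) (x.1 : ℝ), by
      simp only [AffineMap.lineMap_apply_module]
      fun_prop⟩
  let g : unitInterval × Metric.ball (γ T) r → Y.carrier := fun x => Y.lift (H x.2 x.2.2) (T + x.1)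
  have hmem (t : unitInterval) : T + t ∈ Icc 0 (T + 1) :=
    ⟨by linarith [h.nonneg, t.2.1], by linarith [t.2.2]⟩
  have hgf : Y.proj ∘ g = f := by
    funext ⟨t, w⟩
    change Y.proj (Y.lift (H w w.2) (T + t)) = AffineMap.lineMap (γ T) (w : ℂ) (t : ℝ)
    rw [proj_lift _ (hmem t), appendSegment_of_ge (by linarith [t.2.1]), add_sub_cancel_left]
  have hg0 (w : Metric.ball (γ T) r) : g (0, w) = Y.lift h T := by
    simp only [g, Icc.coe_zero, add_zero]
    exact lift_appendSegment_left h _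
  -- Homotopy lifting: `g` is constant on the slice at time `0` and continuous along each segment,
  -- which gives joint continuity because `Y.proj` is a separated local homeomorphism.
  have hg : Continuous g := by
    refine Y.isLocalHomeomorph_proj.continuous_lift Y.isSeparatedMap_proj f hgf ?_ fun w => ?_
    · simp only [hg0]
      exact continuous_const
    · exact (continuousOn_lift (H w w.2)).comp_continuous (by fun_prop) hmem
  refine ⟨fun w => if hw : w ∈ Metric.ball (γ T) r then g (1, ⟨w, hw⟩) else Y.base, ?_,
    fun z hz => ?_, ?_, fun w hw => ?_⟩
  · rw [continuousOn_iff_continuous_domRestrict]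
    have : Continuous fun w : Metric.ball (γ T) r => g (1, w) := by fun_prop
    refine this.congr fun w => ?_
    simp [Set.domRestrict]
  · dsimp only
    rw [dif_pos hz]
    refine (congrFun hgf _).trans ?_
    simp [f]
  · have hmem' : γ T ∈ Metric.ball (γ T) r := Metric.mem_ball_self hr
    dsimp only
    rw [dif_pos hmem']
    -- The segment from the centre to itself is constant, hence so is its lift.
    let c : unitInterval → Y.carrier := fun t => g (t, ⟨γ T, hmem'⟩)
    have : EqOn c (fun _ => Y.lift h T) univ := by
      refine eqOn_of_proj_eqOn (a := 0) isPreconnected_univ (by fun_prop) continuousOn_const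
        (fun t _ => ?_) (mem_univ _) (hg0 _)
      rw [proj_lift h (right_mem_Icc.2 h.nonneg)]
      refine (congrFun hgf _).trans ?_
      simp [f]
    exact this (mem_univ 1)
  · dsimp only
    rw [dif_pos hw]
    simp [g]

end EndlessRiemannSurface

/-! ### The universal endless surface -/

namespace DiscreteFilteredSet

open EndlessRiemannSurface

/-- The type of `Ω`-allowed paths, in an arbitrary universe. -/
structure AllowedPath (Ω : DiscreteFilteredSet) : Type u where
  time : ℝ
  toFun : ℝ → ℂ
  isAllowed : Ω.IsAllowedPath time toFun

variable {Ω : DiscreteFilteredSet}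

namespace AllowedPath

/-- The end point of an allowed path. -/
def endpoint (α : AllowedPath.{u} Ω) : ℂ := α.toFun α.time

/-- The end point of the lift of an allowed path to an endless Riemann surface. -/
noncomputable def liftEndpoint (α : AllowedPath.{u} Ω) (Y : EndlessRiemannSurface.{u} Ω) :
    Y.carrier :=
  Y.lift α.isAllowed α.time

theorem proj_liftEndpoint (α : AllowedPath.{u} Ω) (Y : EndlessRiemannSurface.{u} Ω) :
    Y.proj (α.liftEndpoint Y) = α.endpoint :=
  proj_lift _ (right_mem_Icc.2 α.isAllowed.nonneg)

open Classical in
/-- The path `α` followed by the segment from its end point to `w`, if this path is allowed. -/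
noncomputable def append (α : AllowedPath.{u} Ω) (w : ℂ) : AllowedPath.{u} Ω :=
  if h : Ω.IsAllowedPath (α.time + 1) (appendSegment α.time α.toFun w) then ⟨_, _, h⟩ else α

/-- The radius is chosen before `Y`: it depends only on how far `α` can be prolonged. This
uniformity is what lets the sections descend to the quotient. -/
theorem exists_section (α : AllowedPath.{u} Ω) :
    ∃ r > 0, (∀ w ∈ Metric.ball α.endpoint r, (α.append w).endpoint = w) ∧
      ∀ Y : EndlessRiemannSurface.{u} Ω, ∃ σ : ℂ → Y.carrier,
        ContinuousOn σ (Metric.ball α.endpoint r) ∧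
        (∀ z ∈ Metric.ball α.endpoint r, Y.proj (σ z) = z) ∧
        σ α.endpoint = α.liftEndpoint Y ∧
        ∀ w ∈ Metric.ball α.endpoint r, (α.append w).liftEndpoint Y = σ w := by
  obtain ⟨r, hr, H⟩ := α.isAllowed.exists_appendSegment
  refine ⟨r, hr, fun w hw => ?_, fun Y => ?_⟩
  · rw [append, dif_pos (H w hw)]
    exact appendSegment_end
  · obtain ⟨σ, hσ, hproj, h0, hlift⟩ :=
      EndlessRiemannSurface.exists_section (Y := Y) α.isAllowed hr H
    refine ⟨σ, hσ, hproj, h0, fun w hw => ?_⟩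
    rw [append, dif_pos (H w hw)]
    exact hlift w hw

/-- Two allowed paths are equivalent if they have the same end point, and their lifts to every
endless Riemann surface have the same end point. -/
def setoid (Ω : DiscreteFilteredSet) : Setoid (AllowedPath.{u} Ω) where
  -- Quantifying over surfaces of universe `u` stays in `Prop`, so the quotient still lives in `Type
  -- u`. The first condition would follow from the second only if some surface were already known to
  -- exist.
  r α β := α.endpoint = β.endpoint ∧
    ∀ Y : EndlessRiemannSurface.{u} Ω, α.liftEndpoint Y = β.liftEndpoint Y
  iseqv :=
    ⟨fun _ => ⟨rfl, fun _ => rfl⟩, fun h => ⟨h.1.symm, fun Y => (h.2 Y).symm⟩,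
      fun h h' => ⟨h.1.trans h'.1, fun Y => (h.2 Y).trans (h'.2 Y)⟩⟩

end AllowedPath

/-- The points of the universal endless Riemann surface: allowed paths up to equivalence. -/
def UniversalCarrier (Ω : DiscreteFilteredSet) : Type u :=
  Quotient (AllowedPath.setoid.{u} Ω)

namespace UniversalCarrier

/-- The class of an allowed path. -/
def mk (α : AllowedPath.{u} Ω) : UniversalCarrier.{u} Ω := Quotient.mk _ α

/-- The projection to `ℂ`. -/
def proj : UniversalCarrier.{u} Ω → ℂ := Quotient.lift (fun α => α.endpoint) fun _ _ h => h.1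

/-- The map to an endless Riemann surface, given by lifting allowed paths. -/
noncomputable def toSurface (Y : EndlessRiemannSurface.{u} Ω) :
    UniversalCarrier.{u} Ω → Y.carrier :=
  Quotient.lift (fun α => α.liftEndpoint Y) fun _ _ h => h.2 Y

theorem mk_surjective : Function.Surjective (mk : AllowedPath.{u} Ω → _) :=
  Quotient.mk_surjective

@[ext] theorem ext {x y : UniversalCarrier.{u} Ω} (h : proj x = proj y)
    (h' : ∀ Y, toSurface Y x = toSurface Y y) : x = y := by
  obtain ⟨α, rfl⟩ := mk_surjective x
  obtain ⟨β, rfl⟩ := mk_surjective y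
  exact Quotient.sound ⟨h, h'⟩

theorem proj_toSurface (Y : EndlessRiemannSurface.{u} Ω) (x : UniversalCarrier.{u} Ω) :
    Y.proj (toSurface Y x) = proj x := by
  obtain ⟨α, rfl⟩ := mk_surjective x
  exact α.proj_liftEndpoint Y

/-- The germ of section through a point, obtained by following segments. -/
noncomputable def germ (x : UniversalCarrier.{u} Ω) (w : ℂ) : UniversalCarrier.{u} Ω :=
  mk ((mk_surjective x).choose.append w)

/-- The representative chosen in `germ` is harmless: its end point and the end points of its lifts
depend only on `x`. -/
theorem exists_section (x : UniversalCarrier.{u} Ω) :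
    ∃ r > 0, (∀ w ∈ Metric.ball (proj x) r, proj (germ x w) = w) ∧
      ∀ Y : EndlessRiemannSurface.{u} Ω, ∃ σ : ℂ → Y.carrier,
        ContinuousOn σ (Metric.ball (proj x) r) ∧
        (∀ z ∈ Metric.ball (proj x) r, Y.proj (σ z) = z) ∧
        σ (proj x) = toSurface Y x ∧
        ∀ w ∈ Metric.ball (proj x) r, toSurface Y (germ x w) = σ w := by
  have hx := (mk_surjective x).choose_spec
  have := (mk_surjective x).choose.exists_section
  have h1 : (mk_surjective x).choose.endpoint = proj x := congrArg proj hx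
  have h2 (Y) : (mk_surjective x).choose.liftEndpoint Y = toSurface Y x :=
    congrArg (toSurface Y) hx
  simp only [h1, h2] at this
  exact this

/-- For coherence, the prolongations through `w` and the direct ones are different paths, but in
each `Y` they give sections over two discs that agree at `w`, hence on the convex intersection. -/
theorem isGermFamily_germ : IsGermFamily (proj (Ω := Ω)) germ.{u} where
  self x := by
    obtain ⟨r, hr, hproj, hsec⟩ := exists_section x
    have hx : proj x ∈ Metric.ball (proj x) r := Metric.mem_ball_self hr
    refine ext (hproj _ hx) fun Y => ?_
    obtain ⟨σ, -, -, h0, hσ⟩ := hsec Y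
    rw [hσ _ hx, h0]
  proj x := by
    obtain ⟨r, hr, hproj, -⟩ := exists_section x
    exact mem_of_superset (Metric.ball_mem_nhds _ hr) hproj
  coherent x := by
    obtain ⟨r, hr, hproj, hsec⟩ := exists_section x
    filter_upwards [Metric.ball_mem_nhds _ hr] with w hw
    obtain ⟨r', hr', hproj', hsec'⟩ := exists_section (germ x w)
    rw [hproj w hw] at hproj' hsec'
    have hww : w ∈ Metric.ball w r' := Metric.mem_ball_self hr'
    filter_upwards [Metric.ball_mem_nhds w hr', Metric.isOpen_ball.mem_nhds hw] with v hv' hv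
    refine ext ((hproj' v hv').trans (hproj v hv).symm) fun Y => ?_
    obtain ⟨σ, hσc, hσp, -, hσ⟩ := hsec Y
    obtain ⟨τ, hτc, hτp, hτ0, hτ⟩ := hsec' Y
    rw [hσ v hv, hτ v hv']
    refine eqOn_of_proj_eqOn (S := Metric.ball w r' ∩ Metric.ball (proj x) r)
      ((convex_ball _ _).inter (convex_ball _ _)).isPreconnected (hτc.mono inter_subset_left)
      (hσc.mono inter_subset_right) (fun z hz => ?_) ⟨hww, hw⟩ ?_ ⟨hv', hv⟩
    · rw [hτp z hz.1, hσp z hz.2]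
    · rw [hτ0, hσ w hw]

noncomputable instance : TopologicalSpace (UniversalCarrier.{u} Ω) := etaleTopology proj germ

theorem isLocalHomeomorph_proj : IsLocalHomeomorph (proj.{u} (Ω := Ω)) :=
  isGermFamily_germ.{u}.isLocalHomeomorph

theorem continuous_toSurface (Y : EndlessRiemannSurface.{u} Ω) : Continuous (toSurface Y) := by
  refine continuous_iff_continuousAt.2 fun x => isGermFamily_germ.continuousAt_iff.2 ?_
  obtain ⟨r, hr, -, hsec⟩ := exists_section x
  obtain ⟨σ, hσc, -, h0, hσ⟩ := hsec Y
  have hball := Metric.ball_mem_nhds (proj x) hr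
  rw [← h0]
  refine (hσc.continuousAt hball).tendsto.congr' ?_
  filter_upwards [hball] with w hw
  exact (hσ w hw).symm

instance : T2Space (UniversalCarrier.{u} Ω) := by
  refine ⟨fun x y hxy => ?_⟩
  by_cases h : proj x = proj y
  · obtain ⟨Y, hY⟩ : ∃ Y, toSurface Y x ≠ toSurface Y y := by
      by_contra! h'
      exact hxy (ext h h')
    exact separated_by_continuous (continuous_toSurface Y) hY
  · exact separated_by_continuous isLocalHomeomorph_proj.continuous h

/-- The class of the constant path. -/
def base (Ω : DiscreteFilteredSet) : UniversalCarrier.{u} Ω := mk ⟨0, 0, isAllowedPath_zero⟩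

open Classical in
/-- The lift of an allowed path, given by the classes of its truncations. -/
noncomputable def pathLift {T : ℝ} {γ : ℝ → ℂ} (h : Ω.IsAllowedPath T γ) (t : ℝ) :
    UniversalCarrier.{u} Ω :=
  if ht : t ∈ Icc 0 T then mk ⟨t, γ, h.truncate ht⟩ else base Ω

section pathLift

variable {T : ℝ} {γ : ℝ → ℂ} (h : Ω.IsAllowedPath T γ)

theorem pathLift_of_mem {t : ℝ} (ht : t ∈ Icc 0 T) :
    pathLift.{u} h t = mk ⟨t, γ, h.truncate ht⟩ := dif_pos ht

theorem proj_pathLift {t : ℝ} (ht : t ∈ Icc 0 T) : proj (pathLift.{u} h t) = γ t := by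
  rw [pathLift_of_mem h ht]
  rfl

theorem toSurface_pathLift (Y : EndlessRiemannSurface.{u} Ω) {t : ℝ} (ht : t ∈ Icc 0 T) :
    toSurface Y (pathLift h t) = Y.lift h t := by
  rw [pathLift_of_mem h ht]
  exact lift_truncate h ht

theorem toSurface_base (Y : EndlessRiemannSurface.{u} Ω) : toSurface Y (base Ω) = Y.base :=
  lift_zero isAllowedPath_zero

theorem pathLift_zero : pathLift.{u} h 0 = base Ω := by
  have h0 : (0 : ℝ) ∈ Icc 0 T := left_mem_Icc.2 h.nonneg
  refine ext ((proj_pathLift h h0).trans h.start) fun Y => ?_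
  rw [toSurface_pathLift h Y h0, lift_zero, toSurface_base]

/-- Near `t₀` the classes of truncations follow the germ at `t₀`: in each `Y`, the lift of `γ` and
`σ ∘ γ` both lift `γ` on an interval and agree at `t₀`. -/
theorem continuousOn_pathLift : ContinuousOn (pathLift.{u} h) (Icc 0 T) := by
  intro t₀ ht₀
  have hcont := h.continuousOn t₀ ht₀
  refine isGermFamily_germ.continuousWithinAt
    (hcont.congr (fun t ht => proj_pathLift h ht) (proj_pathLift h ht₀)) ?_
  obtain ⟨r, hr, hproj, hsec⟩ := exists_section (pathLift.{u} h t₀)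
  rw [proj_pathLift h ht₀] at hproj hsec
  obtain ⟨δ, hδ, hγ⟩ := Metric.mem_nhdsWithin_iff.1 (hcont (Metric.ball_mem_nhds _ hr))
  filter_upwards [inter_mem_nhdsWithin _ (Metric.ball_mem_nhds t₀ hδ)] with t ht
  have hmem : γ t ∈ Metric.ball (γ t₀) r := hγ ht.symm
  rw [proj_pathLift h ht.1]
  refine ext ((proj_pathLift h ht.1).trans (hproj _ hmem).symm) fun Y => ?_
  obtain ⟨σ, hσc, hσp, h0, hσ⟩ := hsec Y
  rw [toSurface_pathLift h Y ht.1, hσ _ hmem]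
  refine eqOn_of_proj_eqOn (g := σ ∘ γ) (S := Icc 0 T ∩ Metric.ball t₀ δ) (a := t₀)
    ((convex_Icc _ _).inter (convex_ball _ _)).isPreconnected
    ((continuousOn_lift h).mono inter_subset_left)
    (hσc.comp (h.continuousOn.mono inter_subset_left) fun s hs => hγ hs.symm) (fun s hs => ?_)
    ⟨ht₀, Metric.mem_ball_self hδ⟩ ?_ ht
  · rw [proj_lift h hs.1, Function.comp_apply, hσp _ (hγ hs.symm)]
  · rw [Function.comp_apply, h0, toSurface_pathLift h Y ht₀]

end pathLift

instance : ConnectedSpace (UniversalCarrier.{u} Ω) where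
  toPreconnectedSpace := by
    refine ⟨isPreconnected_of_forall (base Ω) fun x _ => ?_⟩
    obtain ⟨⟨T, γ, h⟩, rfl⟩ := mk_surjective x
    refine ⟨pathLift h '' Icc 0 T, subset_univ _,
      ⟨0, left_mem_Icc.2 h.nonneg, pathLift_zero h⟩,
      ⟨T, right_mem_Icc.2 h.nonneg, pathLift_of_mem h (right_mem_Icc.2 h.nonneg)⟩,
      isPreconnected_Icc.image _ (continuousOn_pathLift h)⟩
  toNonempty := ⟨base Ω⟩

end UniversalCarrier

/-- The universal `Ω`-endless Riemann surface. -/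
noncomputable def universalSurface (Ω : DiscreteFilteredSet) : EndlessRiemannSurface.{u} Ω :=
  ofLocalHomeomorph UniversalCarrier.proj UniversalCarrier.isLocalHomeomorph_proj
    (UniversalCarrier.base Ω) rfl fun _ _ h => ⟨UniversalCarrier.pathLift h,
      UniversalCarrier.continuousOn_pathLift h, UniversalCarrier.pathLift_zero h,
      fun _ => UniversalCarrier.proj_pathLift h⟩

theorem isCofinal_universalSurface (Ω : DiscreteFilteredSet) :
    (universalSurface.{u} Ω).IsCofinal := fun Y =>
  ⟨UniversalCarrier.toSurface Y, isMorphism_of_continuous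
    (UniversalCarrier.continuous_toSurface Y) (UniversalCarrier.toSurface_base Y)
    (funext (UniversalCarrier.proj_toSurface Y))⟩

end DiscreteFilteredSet

/-! ### Homotopy classes of paths -/

/-- Two paths with the same end points in the image of a section over a convex set are
homotopic. -/
theorem Path.Homotopic.of_section {X V : Type*} [TopologicalSpace X] [AddCommGroup V] [Module ℝ V]
    [TopologicalSpace V] [IsTopologicalAddGroup V] [ContinuousSMul ℝ V] {p : X → V}
    (hp : Continuous p) {B : Set V} (hB : Convex ℝ B) {σ : V → X} (hσ : ContinuousOn σ B)
    {x y : X} {β β' : Path x y} (hβ : ∀ t, p (β t) ∈ B ∧ σ (p (β t)) = β t)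
    (hβ' : ∀ t, p (β' t) ∈ B ∧ σ (p (β' t)) = β' t) : β.Homotopic β' := by
  -- The straight-line homotopy between the projections stays in `B`; it is lifted by `σ`.
  refine ⟨{ toFun := fun z => σ (AffineMap.lineMap (p (β z.2)) (p (β' z.2)) (z.1 : ℝ))
            continuous_toFun := ?_, map_zero_left := ?_, map_one_left := ?_, prop' := ?_ }⟩
  · refine hσ.comp_continuous ?_ fun z => hB.lineMap_mem (hβ _).1 (hβ' _).1 z.1.2
    simp only [AffineMap.lineMap_apply_module]
    fun_prop
  · intro t
    simp [(hβ t).2]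
  · intro t
    simp [(hβ' t).2]
  · rintro s t (rfl | rfl)
    · have := (hβ 0).2
      simp_all
    · have := (hβ 1).2
      simp_all

theorem Path.Homotopic.Quotient.trans_right_cancel {X : Type*} [TopologicalSpace X] {x y z : X}
    {a a' : Path.Homotopic.Quotient x y} {b : Path.Homotopic.Quotient y z}
    (h : a.trans b = a'.trans b) : a = a' := by
  have := congrArg (fun c => c.trans b.symm) h
  simpa using this

theorem Path.Homotopic.Quotient.trans_left_cancel {X : Type*} [TopologicalSpace X] {x y z : X}
    {a : Path.Homotopic.Quotient x y} {b b' : Path.Homotopic.Quotient y z}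
    (h : a.trans b = a.trans b') : b = b' := by
  have := congrArg (fun c => a.symm.trans c) h
  simpa [← Path.Homotopic.Quotient.trans_assoc] using this

/-- The path `Γ` on the interval between `s` and `t`, parametrized by the unit interval. -/
def Continuous.pathBetween {X : Type*} [TopologicalSpace X] {Γ : ℝ → X} (hΓ : Continuous Γ)
    {x y : X} (s t : ℝ) (hs : Γ s = x) (ht : Γ t = y) : Path x y where
  toFun τ := Γ (AffineMap.lineMap s t (τ : ℝ))
  continuous_toFun := by
    simp only [AffineMap.lineMap_apply_module]
    fun_prop
  source' := by simp [hs]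
  target' := by simp [ht]

/-- The identity holds in the simply connected space `ℝ` and is transported by `Γ`. -/
theorem Continuous.mk_pathBetween_trans {X : Type*} [TopologicalSpace X] {Γ : ℝ → X}
    (hΓ : Continuous Γ) {x y z : X} {r s t : ℝ} (hr : Γ r = x) (hs : Γ s = y) (ht : Γ t = z) :
    (Path.Homotopic.Quotient.mk (hΓ.pathBetween r s hr hs)).trans
      (.mk (hΓ.pathBetween s t hs ht)) = .mk (hΓ.pathBetween r t hr ht) := by
  subst hr hs ht
  have hid : Continuous (id : ℝ → ℝ) := continuous_id
  have key (a b : ℝ) : hΓ.pathBetween a b rfl rfl = (hid.pathBetween a b rfl rfl).map hΓ := rfl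
  rw [← Path.Homotopic.Quotient.mk_trans, Path.Homotopic.Quotient.eq, key r s, key s t, key r t,
    ← Path.map_trans]
  exact (SimplyConnectedSpace.paths_homotopic _ _).map ⟨Γ, hΓ⟩

/-! ### The surface of homotopy classes of paths from the base point -/

namespace EndlessRiemannSurface

variable {Ω : DiscreteFilteredSet} (Y : EndlessRiemannSurface.{u} Ω)

theorem exists_localSection (x : Y.carrier) : ∃ r > 0, ∃ σ : ℂ → Y.carrier,
    ContinuousOn σ (Metric.ball (Y.proj x) r) ∧
    (∀ z ∈ Metric.ball (Y.proj x) r, Y.proj (σ z) = z) ∧ σ (Y.proj x) = x := by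
  obtain ⟨e, hx, he⟩ := Y.isLocalHomeomorph_proj x
  obtain ⟨r, hr, hball⟩ := Metric.isOpen_iff.1 e.open_target (Y.proj x) (he ▸ e.map_source hx)
  exact ⟨r, hr, e.symm, e.continuousOn_symm.mono hball,
    fun z hz => by rw [he, e.right_inv (hball hz)], by rw [he, e.left_inv hx]⟩

/-- The disc around the projection of a point over which a section through it is chosen. -/
noncomputable def disc (x : Y.carrier) : Set ℂ :=
  Metric.ball (Y.proj x) (Y.exists_localSection x).choose

/-- A local section of the projection through a given point. -/
noncomputable def localSection (x : Y.carrier) : ℂ → Y.carrier :=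
  (Y.exists_localSection x).choose_spec.2.choose

variable {Y}

theorem disc_mem_nhds (x : Y.carrier) : Y.disc x ∈ 𝓝 (Y.proj x) :=
  Metric.ball_mem_nhds _ (Y.exists_localSection x).choose_spec.1

theorem isOpen_disc (x : Y.carrier) : IsOpen (Y.disc x) := Metric.isOpen_ball

theorem mem_disc_self (x : Y.carrier) : Y.proj x ∈ Y.disc x := mem_of_mem_nhds (disc_mem_nhds x)

theorem convex_disc (x : Y.carrier) : Convex ℝ (Y.disc x) := convex_ball _ _

theorem continuousOn_localSection (x : Y.carrier) : ContinuousOn (Y.localSection x) (Y.disc x) :=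
  (Y.exists_localSection x).choose_spec.2.choose_spec.1

theorem proj_localSection {x : Y.carrier} {z : ℂ} (hz : z ∈ Y.disc x) :
    Y.proj (Y.localSection x z) = z :=
  (Y.exists_localSection x).choose_spec.2.choose_spec.2.1 z hz

theorem localSection_proj (x : Y.carrier) : Y.localSection x (Y.proj x) = x :=
  (Y.exists_localSection x).choose_spec.2.choose_spec.2.2

theorem eqOn_localSection {A : Type*} [TopologicalSpace A] {S : Set A} (hS : IsPreconnected S)
    {f : A → Y.carrier} (hf : ContinuousOn f S) {a : A} (ha : a ∈ S)
    (hmaps : ∀ b ∈ S, Y.proj (f b) ∈ Y.disc (f a)) {b : A} (hb : b ∈ S) :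
    Y.localSection (f a) (Y.proj (f b)) = f b :=
  (eqOn_of_proj_eqOn (g := fun b => Y.localSection (f a) (Y.proj (f b))) hS hf
    ((continuousOn_localSection (f a)).comp
      (Y.isLocalHomeomorph_proj.continuous.comp_continuousOn hf) hmaps)
    (fun c hc => (proj_localSection (hmaps c hc)).symm) ha (localSection_proj (f a)).symm hb).symm

theorem localSection_localSection {x : Y.carrier} {w v : ℂ} (hw : w ∈ Y.disc x)
    (hv : v ∈ Y.disc x) (hv' : v ∈ Y.disc (Y.localSection x w)) :
    Y.localSection (Y.localSection x w) v = Y.localSection x v := by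
  have hw' := mem_disc_self (Y.localSection x w)
  rw [proj_localSection hw] at hw'
  have := eqOn_localSection (a := w) (b := v)
    ((convex_disc x).inter (convex_disc (Y.localSection x w))).isPreconnected
    ((continuousOn_localSection x).mono inter_subset_left) ⟨hw, hw'⟩
    (fun b hb => by rw [proj_localSection hb.1]; exact hb.2) ⟨hv, hv'⟩
  rwa [proj_localSection hv] at this

/-- The lift of a segment to the local section through `x`. -/
noncomputable def segmentPath (x : Y.carrier) {w : ℂ} (hw : w ∈ Y.disc x) :
    Path x (Y.localSection x w) where
  toFun t := Y.localSection x (AffineMap.lineMap (Y.proj x) w (t : ℝ))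
  continuous_toFun := by
    refine (continuousOn_localSection x).comp_continuous ?_
      fun t => (convex_disc x).lineMap_mem (mem_disc_self x) hw t.2
    simp only [AffineMap.lineMap_apply_module]
    fun_prop
  source' := by simp [localSection_proj]
  target' := by simp

theorem segmentPath_apply {x : Y.carrier} {w : ℂ} (hw : w ∈ Y.disc x) (t : unitInterval) :
    segmentPath x hw t = Y.localSection x (AffineMap.lineMap (Y.proj x) w (t : ℝ)) := rfl

theorem segmentPath_mem {x : Y.carrier} {w : ℂ} (hw : w ∈ Y.disc x) (t : unitInterval) :
    Y.proj (segmentPath x hw t) ∈ Y.disc x ∧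
      Y.localSection x (Y.proj (segmentPath x hw t)) = segmentPath x hw t := by
  have := (convex_disc x).lineMap_mem (mem_disc_self x) hw t.2
  rw [segmentPath_apply, proj_localSection this]
  exact ⟨this, rfl⟩

variable (Y) in
/-- The homotopy classes of paths from the base point. -/
def HomotopyCover : Type u := Σ x : Y.carrier, Path.Homotopic.Quotient Y.base x

namespace HomotopyCover

/-- The projection to `ℂ`. -/
def proj (e : Y.HomotopyCover) : ℂ := Y.proj e.1

open Classical in
/-- The germ of section through a point, obtained by following segments. -/
noncomputable def germ (e : Y.HomotopyCover) (w : ℂ) : Y.HomotopyCover :=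
  if hw : w ∈ Y.disc e.1 then ⟨Y.localSection e.1 w, e.2.trans (.mk (segmentPath e.1 hw))⟩ else e

theorem germ_of_mem {e : Y.HomotopyCover} {w : ℂ} (hw : w ∈ Y.disc e.1) :
    germ e w = ⟨Y.localSection e.1 w, e.2.trans (.mk (segmentPath e.1 hw))⟩ := dif_pos hw

/-- Both continuations lie in one section over a convex disc, hence are homotopic. The equality is
in the total space because `y` and `y'` are only propositionally equal. -/
theorem mk_trans_eq {b x y y' c : Y.carrier} (a : Path.Homotopic.Quotient b x) (β : Path x y)
    (β' : Path x y') (h : y = y')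
    (hβ : ∀ t, Y.proj (β t) ∈ Y.disc c ∧ Y.localSection c (Y.proj (β t)) = β t)
    (hβ' : ∀ t, Y.proj (β' t) ∈ Y.disc c ∧ Y.localSection c (Y.proj (β' t)) = β' t) :
    (⟨y, a.trans (.mk β)⟩ : Σ x, Path.Homotopic.Quotient b x) = ⟨y', a.trans (.mk β')⟩ := by
  subst h
  rw [Path.Homotopic.Quotient.eq.2 (Path.Homotopic.of_section
    Y.isLocalHomeomorph_proj.continuous (convex_disc c) (continuousOn_localSection c) hβ hβ')]

theorem isGermFamily_germ : IsGermFamily (proj (Y := Y)) germ where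
  self e := by
    obtain ⟨x, a⟩ := e
    refine (germ_of_mem (mem_disc_self x)).trans ?_
    refine (mk_trans_eq (c := x) a _ (Path.refl x) (localSection_proj x) (segmentPath_mem _)
      fun t => ⟨mem_disc_self x, localSection_proj x⟩).trans ?_
    rw [Path.Homotopic.Quotient.mk_refl, Path.Homotopic.Quotient.trans_refl]
  proj e := by
    filter_upwards [disc_mem_nhds e.1] with w hw
    rw [germ_of_mem hw]
    exact proj_localSection hw
  coherent e := by
    obtain ⟨x, a⟩ := e
    filter_upwards [disc_mem_nhds x] with w hw
    have hnhds := disc_mem_nhds (Y.localSection x w)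
    rw [proj_localSection hw] at hnhds
    filter_upwards [hnhds, (isOpen_disc x).mem_nhds hw] with v hv' hv
    rw [germ_of_mem (e := ⟨x, a⟩) hw, germ_of_mem (e := ⟨x, a⟩) hv]
    refine (germ_of_mem (e := ⟨Y.localSection x w, _⟩) hv').trans ?_
    dsimp only
    rw [Path.Homotopic.Quotient.trans_assoc, ← Path.Homotopic.Quotient.mk_trans]
    -- The broken path through `w` and the direct segment to `v` both lie in the section through
    -- `x`.
    refine mk_trans_eq (c := x) a _ _ (localSection_localSection hw hv hv') (fun t => ?_)
      (segmentPath_mem hv)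
    have hmem (s : unitInterval) : Y.proj (segmentPath _ hv' s) ∈ Y.disc x ∧
        Y.localSection x (Y.proj (segmentPath _ hv' s)) = segmentPath _ hv' s := by
      have h1 := (convex_disc _).lineMap_mem (mem_disc_self (Y.localSection x w)) hv' s.2
      have h2 := (convex_disc x).lineMap_mem hw hv s.2
      rw [segmentPath_apply, proj_localSection h1]
      rw [proj_localSection hw] at h1 ⊢
      exact ⟨h2, (localSection_localSection hw h2 h1).symm⟩
    rw [Path.trans_apply]
    split_ifs
    · exact segmentPath_mem hw _
    · exact hmem _

noncomputable instance : TopologicalSpace Y.HomotopyCover := etaleTopology proj germ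

theorem isLocalHomeomorph_proj : IsLocalHomeomorph (proj (Y := Y)) :=
  isGermFamily_germ.isLocalHomeomorph

theorem continuous_fst : Continuous (fun e : Y.HomotopyCover => e.1) := by
  refine continuous_iff_continuousAt.2 fun e => isGermFamily_germ.continuousAt_iff.2 ?_
  have := ((continuousOn_localSection e.1).continuousAt (disc_mem_nhds e.1)).tendsto
  rw [localSection_proj] at this
  refine this.congr' ?_
  filter_upwards [disc_mem_nhds e.1] with w hw
  rw [germ_of_mem hw]

instance : T2Space Y.HomotopyCover := by
  refine t2Space_iff_disjoint_nhds.2 fun e e' hne => ?_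
  by_cases h : e.1 = e'.1
  · dsimp only
    rw [isGermFamily_germ.nhds_eq, isGermFamily_germ.nhds_eq]
    obtain ⟨x, a⟩ := e
    obtain ⟨x', a'⟩ := e'
    obtain rfl : x = x' := h
    refine disjoint_of_disjoint_of_mem ?_ (image_mem_map (disc_mem_nhds x))
      (image_mem_map (disc_mem_nhds x))
    rw [disjoint_left]
    rintro _ ⟨w, hw, rfl⟩ ⟨w', hw', heq⟩
    rw [germ_of_mem (e := ⟨x, a⟩) hw, germ_of_mem (e := ⟨x, a'⟩) hw'] at heq
    obtain rfl : w' = w := by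
      have := congrArg Y.proj (Sigma.mk.inj heq).1
      rwa [proj_localSection hw, proj_localSection hw'] at this
    -- A common point of the two sheets lies over one `w`; cancelling the segment to it identifies
    -- the classes.
    have haa : a' = a :=
      Path.Homotopic.Quotient.trans_right_cancel (eq_of_heq (Sigma.mk.inj heq).2)
    exact hne (haa ▸ rfl)
  · exact continuous_fst.continuousAt.tendsto.disjoint (disjoint_nhds_nhds.2 h)
      continuous_fst.continuousAt.tendsto

variable (Y) in
/-- The class of the constant path. -/
def base : Y.HomotopyCover := ⟨Y.base, .refl Y.base⟩

section pathLift

variable {Γ : ℝ → Y.carrier} (hΓ : Continuous Γ) (h0 : Γ 0 = Y.base)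

/-- The lift of a path, given by the classes of its truncations. -/
def pathLift (t : ℝ) : Y.HomotopyCover := ⟨Γ t, .mk (hΓ.pathBetween 0 t h0 rfl)⟩

theorem pathLift_eq_mk {x : Y.carrier} {t : ℝ} (ht : Γ t = x) {α : Path Y.base x}
    (hα : ∀ τ : unitInterval, α τ = Γ (τ * t)) : pathLift hΓ h0 t = ⟨x, .mk α⟩ := by
  subst ht
  have : hΓ.pathBetween 0 t h0 rfl = α := by
    ext τ
    rw [hα]
    simp [Continuous.pathBetween, AffineMap.lineMap_apply]
  rw [pathLift, this]

theorem pathLift_zero : pathLift hΓ h0 0 = base Y :=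
  pathLift_eq_mk hΓ h0 h0 (α := Path.refl Y.base) fun τ => by simp [h0]

/-- The class at `t` is the class at `t₀` followed by `Γ` from `t₀` to `t`, a piece lying in the
section through `Γ t₀` when `t` is close to `t₀`. -/
theorem continuous_pathLift : Continuous (pathLift hΓ h0) := by
  have hproj : Continuous (Y.proj ∘ Γ) := Y.isLocalHomeomorph_proj.continuous.comp hΓ
  refine continuousOn_univ.1 fun t₀ _ => isGermFamily_germ.continuousWithinAt
    hproj.continuousAt.continuousWithinAt ?_
  rw [nhdsWithin_univ]
  obtain ⟨δ, hδ, hball⟩ := Metric.mem_nhds_iff.1 (hproj.continuousAt (disc_mem_nhds (Γ t₀)))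
  have hsec {s : ℝ} (hs : s ∈ Metric.ball t₀ δ) :
      Y.localSection (Γ t₀) (Y.proj (Γ s)) = Γ s :=
    eqOn_localSection (convex_ball t₀ δ).isPreconnected hΓ.continuousOn
      (Metric.mem_ball_self hδ) (fun b hb => hball hb) hs
  filter_upwards [Metric.ball_mem_nhds t₀ hδ] with t ht
  refine Eq.trans ?_ (germ_of_mem (e := pathLift hΓ h0 t₀) (w := Y.proj (Γ t)) (hball ht)).symm
  rw [pathLift, ← hΓ.mk_pathBetween_trans h0 (rfl : Γ t₀ = Γ t₀) rfl]
  refine mk_trans_eq (c := Γ t₀) _ _ _ (hsec ht).symm (fun τ => ?_) (segmentPath_mem _)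
  have hτ : AffineMap.lineMap t₀ t (τ : ℝ) ∈ Metric.ball t₀ δ :=
    (convex_ball t₀ δ).lineMap_mem (Metric.mem_ball_self hδ) ht τ.2
  exact ⟨hball hτ, hsec hτ⟩

end pathLift

theorem pathLift_extend_one {x : Y.carrier} (α : Path Y.base x) :
    pathLift α.continuous_extend α.extend_zero 1 = ⟨x, .mk α⟩ :=
  pathLift_eq_mk _ _ α.extend_one fun τ => by simp

instance : ConnectedSpace Y.HomotopyCover where
  toPreconnectedSpace := by
    refine ⟨isPreconnected_of_forall (base Y) fun x _ => ?_⟩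
    obtain ⟨x, a⟩ := x
    obtain ⟨α, rfl⟩ := Path.Homotopic.Quotient.mk_surjective a
    exact ⟨range (pathLift α.continuous_extend α.extend_zero), subset_univ _,
      ⟨0, pathLift_zero _ _⟩, ⟨1, pathLift_extend_one α⟩,
      isPreconnected_range (continuous_pathLift _ _)⟩
  toNonempty := ⟨base Y⟩

variable (Y) in
/-- The homotopy classes of paths from the base point of an `Ω`-endless Riemann surface form an
`Ω`-endless Riemann surface. -/
noncomputable def surface : EndlessRiemannSurface.{u} Ω :=
  ofLocalHomeomorph proj isLocalHomeomorph_proj (base Y) Y.proj_base fun T γ h => by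
    -- The lift is extended by constants outside `Icc 0 T`, since `pathLift` takes a path continuous
    -- on `ℝ`.
    have hcont : Continuous (IccExtend h.nonneg ((Icc 0 T).domRestrict (Y.lift h))) :=
      (continuousOn_iff_continuous_domRestrict.1 (continuousOn_lift h)).Icc_extend'
    have heq {t : ℝ} (ht : t ∈ Icc 0 T) :
        IccExtend h.nonneg ((Icc 0 T).domRestrict (Y.lift h)) t = Y.lift h t :=
      IccExtend_of_mem _ _ ht
    have h0 := (heq (left_mem_Icc.2 h.nonneg)).trans (lift_zero h)
    refine ⟨pathLift hcont h0, (continuous_pathLift hcont h0).continuousOn,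
      pathLift_zero hcont h0, fun t ht => ?_⟩
    exact (congrArg Y.proj (heq ht)).trans (proj_lift h ht)

end HomotopyCover

/-! ### Simple connectedness and conclusion -/

theorem IsCofinal.simplyConnectedSpace (hY : Y.IsCofinal) : SimplyConnectedSpace Y.carrier := by
  obtain ⟨q, hq⟩ := hY (HomotopyCover.surface Y)
  -- The right-hand side does not involve `α`: any two paths from the base point to `x` are
  -- homotopic.
  have key {x : Y.carrier} (α : Path Y.base x) : (⟨x, .mk α⟩ : Y.HomotopyCover) = q x := by
    rw [← HomotopyCover.pathLift_extend_one α]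
    have := eqOn_of_proj_eqOn (Y := HomotopyCover.surface Y) (a := 0)
      (f := HomotopyCover.pathLift α.continuous_extend α.extend_zero) (g := q ∘ α.extend)
      isPreconnected_univ (HomotopyCover.continuous_pathLift _ _).continuousOn
      (hq.continuous.comp α.continuous_extend).continuousOn
      (fun t _ => (hq.proj_apply (α.extend t)).symm) (mem_univ _)
      ((HomotopyCover.pathLift_zero _ _).trans
        (by rw [Function.comp_apply, α.extend_zero, hq.map_base]; rfl)) (mem_univ 1)
    rwa [Function.comp_apply, α.extend_one] at this
  have : LocallyPathConnectedSpace Y.carrier :=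
    ChartedSpace.locallyPathConnectedSpace ℂ Y.carrier
  have hpath : PathConnectedSpace Y.carrier :=
    pathConnectedSpace_iff_connectedSpace.2 inferInstance
  refine simply_connected_iff_paths_homotopic'.2 ⟨hpath, fun {x y} p₁ p₂ => ?_⟩
  -- Preceding both paths by `δ` makes them start at the base point; `δ` is cancelled at the end.
  let δ := hpath.somePath Y.base x
  have := eq_of_heq (Sigma.mk.inj ((key (δ.trans p₁)).trans (key (δ.trans p₂)).symm)).2
  rw [Path.Homotopic.Quotient.mk_trans, Path.Homotopic.Quotient.mk_trans] at this
  exact Path.Homotopic.Quotient.eq.1 (Path.Homotopic.Quotient.trans_left_cancel this)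

end EndlessRiemannSurface

theorem proposition2 (Ω : DiscreteFilteredSet) :
    ∃ X : EndlessRiemannSurface.{u} Ω,
      X.IsCofinal ∧
      (∀ Y : EndlessRiemannSurface.{u} Ω, Y.IsCofinal → X.IsIsomorphic Y) ∧
      SimplyConnectedSpace X.carrier := by
  have hX := Ω.isCofinal_universalSurface
  refine ⟨Ω.universalSurface, hX, fun Y hY => ?_, hX.simplyConnectedSpace⟩
  obtain ⟨q, hq⟩ := hX Y
  obtain ⟨r, hr⟩ := hY Ω.universalSurface
  exact hq.isIsomorphic hr
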